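/- Let $n$ be an odd prime. Let $\mathrm{PSL}_2(n)$ be the group of permutations $x\mapsto\frac{ax+c}{bx+d}$ ($a,b,c,d\in\mathrm{GF}(n)$, $ad-bc=1$) of $\mathrm{GF}(n)\cup\{\infty\}$, with the usual conventions for $\infty$. It acts on binary words of length $n+1$, with coordinates indexed by $\mathrm{GF}(n)\cup\{\infty\}$, by $\tau\big((c_x)_x\big)=(c_{\tau(x)})_x$. Let $\widetilde{C}\subseteq\mathrm{GF}(2)^{n+1}$ be a binary linear code (a linear subspace) that is invariant under $\mathrm{PSL}_2(n)$, i.e. $\tau(\widetilde C)=\widetilde C$ for all $\tau\in\mathrm{PSL}_2(n)$. Then $\widetilde{C}$ is one of the following: 1. the zero code $\{(0,\dots,0)\}$; 2. the whole space $\mathrm{GF}(2)^{n+1}$; 3. the repetition code $\{(0,\dots,0),(1,\dots,1)\}$; 4. the even-weight code $\{c\in\mathrm{GF}(2)^{n+1}:\sum_x c_x=0\}$; 5. the extended code $\overline{D}=\{(c_0,\dots,c_{n-1},c_\infty):(c_0,\dots,c_{n-1})\in D,\ c_\infty=-\sum_{i=0}^{n-1}c_i\}$ of one of the two odd-like binary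 quadratic residue codes $D$ of length $n$. Here the odd-like binary quadratic residue codes of length $n$ are defined when $2$ is a quadratic residue modulo $n$, as follows. Let $m$ be the multiplicative order of $2$ modulo $n$, let $\alpha$ be any generator of $\mathrm{GF}(2^m)^*$, and put $\beta=\alpha^{(2^m-1)/n}$. Let $\mathcal{Q}$ and $\mathcal{N}$ be the sets of nonzero quadratic residues and of quadratic nonresidues modulo $n$. The two codes are the ideals of $\mathrm{GF}(2)[x]/(x^n-1)$ generated by $g_0(x)=\prod_{i\in\mathcal{Q}}(x-\beta^i)$ and $g_1(x)=\prod_{i\in\mathcal{N}}(x-\beta^i)$ (both lie in $\mathrm{GF}(2)[x]$), where a polynomial $c_0+c_1x+\dots+c_{n-1}x^{n-1}$ is identified with the word $(c_0,\dots,c_{n-1})$. (If $2$ is not a quadratic residue modulo $n$, only cases 1-4 occur.) -/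

import Mathlib

open Polynomial

noncomputable section

namespace PSLCodes

/-- The permutation group `PSL₂(n)` on `GF(n) ∪ {∞}`: all Möbius permutations
`x ↦ (a x + b) / (c x + d)` with `a d - b c = 1`, i.e. the image of `SL₂(GF(n))` in the group of
permutations of the projective line, under Mathlib's action of `GL₂` by Möbius
transformations. -/
def PSL2 (n : ℕ) [Fact n.Prime] : Subgroup (Equiv.Perm (OnePoint (ZMod n))) :=
  ((MulAction.toPermHom (GL (Fin 2) (ZMod n)) (OnePoint (ZMod n))).comp
    Matrix.SpecialLinearGroup.toGL).range

/-- Explicit description of the members of `PSL2 n`. -/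
theorem mem_PSL2_iff (n : ℕ) [Fact n.Prime] (τ : Equiv.Perm (OnePoint (ZMod n))) :
    τ ∈ PSL2 n ↔ ∃ a b c d : ZMod n, a * d - b * c = 1 ∧
      τ OnePoint.infty = (if c = 0 then OnePoint.infty else ((a / c : ZMod n) : OnePoint _)) ∧
      ∀ x : ZMod n, τ (x : OnePoint _) =
        (if c * x + d = 0 then OnePoint.infty
          else (((a * x + b) / (c * x + d) : ZMod n) : OnePoint _)) := by
  constructor
  · rintro ⟨g, rfl⟩
    refine ⟨g 0 0, g 0 1, g 1 0, g 1 1, ?_, ?_, fun x => ?_⟩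
    · rw [← Matrix.det_fin_two, g.det_coe]
    · exact OnePoint.smul_infty_eq_ite _
    · exact OnePoint.smul_some_eq_ite
  · rintro ⟨a, b, c, d, hdet, hinf, hx⟩
    refine ⟨⟨!![a, b; c, d], by rw [Matrix.det_fin_two_of, hdet]⟩, ?_⟩
    ext p
    induction p using OnePoint.rec with
    | infty => rw [hinf]; exact OnePoint.smul_infty_eq_ite _
    | coe x => rw [hx]; exact OnePoint.smul_some_eq_ite

/-- A binary linear code `C` of length `n + 1`, with coordinates indexed by `GF(n) ∪ {∞}`, is
invariant under `PSL₂(n)` if `τ(C) = C` for all `τ ∈ PSL₂(n)`, where a permutation `τ` acts on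
words by `τ(c) = (c_{τ(x)})_x`. -/
def IsPSL2Invariant (n : ℕ) [Fact n.Prime]
    (C : Submodule (ZMod 2) (OnePoint (ZMod n) → ZMod 2)) : Prop :=
  ∀ τ ∈ PSL2 n, C.map (LinearMap.funLeft (ZMod 2) (ZMod 2) τ) = C

/-- The linear map sending a word `(c_0, …, c_{n-1})` to the word extended by the
coordinate `c_∞ = -∑ c_i`. -/
def extendWord (n : ℕ) [Fact n.Prime] :
    (ZMod n → ZMod 2) →ₗ[ZMod 2] (OnePoint (ZMod n) → ZMod 2) where
  toFun c := fun p => p.elim (-∑ i, c i) c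
  map_add' c d := by
    ext p
    induction p using OnePoint.rec with
    | infty => simp only [Pi.add_apply, OnePoint.elim_infty, Finset.sum_add_distrib, neg_add]
    | coe x => rfl
  map_smul' r c := by
    ext p
    induction p using OnePoint.rec with
    | infty => simp [Finset.mul_sum]
    | coe x => rfl

/-- The extended code of a binary linear code of length `n`. -/
def extendedCode (n : ℕ) [Fact n.Prime] (D : Submodule (ZMod 2) (ZMod n → ZMod 2)) :
    Submodule (ZMod 2) (OnePoint (ZMod n) → ZMod 2) :=
  D.map (extendWord n)

/-- The ring `GF(2)[x] / (x^n - 1)`. -/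
abbrev CyclicRing (n : ℕ) : Type :=
  (ZMod 2)[X] ⧸ Ideal.span {(X ^ n - 1 : (ZMod 2)[X])}

/-- The polynomial `c_0 + c_1 x + ⋯ + c_{n-1} x^{n-1}` of a word `c`, as a linear map. -/
def wordPoly (n : ℕ) [Fact n.Prime] : (ZMod n → ZMod 2) →ₗ[ZMod 2] (ZMod 2)[X] :=
  ∑ i : ZMod n, (Polynomial.monomial i.val).comp (LinearMap.proj i)

/-- The cyclic code `⟨g⟩` of length `n`: the words whose polynomial lies, modulo `x^n - 1`, in the
ideal of `GF(2)[x] / (x^n - 1)` generated by `g`. -/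
def cyclicCode (n : ℕ) [Fact n.Prime] (g : (ZMod 2)[X]) :
    Submodule (ZMod 2) (ZMod n → ZMod 2) :=
  ((Ideal.span {(Ideal.Quotient.mk _ g : CyclicRing n)}).restrictScalars (ZMod 2)).comap
    ((Ideal.Quotient.mkₐ (ZMod 2) (Ideal.span {(X ^ n - 1 : (ZMod 2)[X])})).toLinearMap ∘ₗ
      wordPoly n)

/-- The field `GF(2^m)`, where `m` is the multiplicative order of `2` modulo `n`. -/
abbrev RootField (n : ℕ) : Type := GaloisField 2 (orderOf (2 : ZMod n))

/-- The `n`-th root of unity `β = α^((2^m - 1)/n)`. -/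
def rootOfUnity (n : ℕ) (α : (RootField n)ˣ) : RootField n :=
  (α : RootField n) ^ ((2 ^ orderOf (2 : ZMod n) - 1) / n)

/-- The (nonzero) quadratic residues modulo `n`. -/
def residues (n : ℕ) [Fact n.Prime] : Finset (ZMod n) :=
  Finset.univ.filter fun i => i ≠ 0 ∧ IsSquare i

/-- The quadratic nonresidues modulo `n`. -/
def nonresidues (n : ℕ) [Fact n.Prime] : Finset (ZMod n) :=
  Finset.univ.filter fun i => ¬ IsSquare i

/-- `D` is one of the two odd-like binary quadratic residue codes of length `n`. These are defined
when `2` is a quadratic residue modulo `n`, and they are the cyclic codes whose generator polynomial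
`g ∈ GF(2)[x]` is `g_0 = ∏_{i ∈ Q} (x - β^i)` or `g_1 = ∏_{i ∈ N} (x - β^i)`, with `Q` and `N` the
sets of quadratic residues and nonresidues. -/
def IsOddLikeQRCode (n : ℕ) [Fact n.Prime] (β : RootField n)
    (D : Submodule (ZMod 2) (ZMod n → ZMod 2)) : Prop :=
  IsSquare (2 : ZMod n) ∧
    ∃ g : (ZMod 2)[X],
      (g.map (algebraMap (ZMod 2) (RootField n)) =
          ∏ i ∈ residues n, (X - C (β ^ i.val)) ∨
        g.map (algebraMap (ZMod 2) (RootField n)) =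
          ∏ i ∈ nonresidues n, (X - C (β ^ i.val))) ∧
      D = cyclicCode n g

end PSLCodes

end

/-! Write `s` for the sum of the finite coordinates of a codeword. As `n` is odd, adding up its
translates keeps the coordinate at `∞` and puts `s` everywhere else. If `s` differs from the
`∞`-coordinate, this word and its image under `x ↦ -1/x` produce the unit vector at `∞`, and
transitivity makes the code the whole space. So a proper invariant code is the extension of its
punctured code `D`, and if nonzero it contains the all-ones word (`sum_eq_infty`, `one_mem`).

The stabiliser of `∞` contains translations and multiplications by nonzero squares. Translations
make `D` cyclic, with a generator `g` dividing `X ^ n - 1`, which has simple roots; so `g` is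
determined by the set `Z` of exponents `i` with `g(β^i) = 0`. Square multiplications preserve `Z`,
and the all-ones word excludes `0`, so `Z` is empty, `Q`, `N` or all nonzero classes
(`zeroSet_cases`). These give the even-weight code, the two extended residue codes and the
repetition code. Frobenius makes `Z` stable under doubling, which forces `2` to be a residue in the
middle cases. -/

namespace PSLCodes

/-! ### Consequences of invariance under Möbius permutations -/

section Invariance

variable {n : ℕ} [Fact n.Prime] {C : Submodule (ZMod 2) (OnePoint (ZMod n) → ZMod 2)}

theorem zmod_two_eq_one {x : ZMod 2} (h : x ≠ 0) : x = 1 := by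
  revert x; decide

theorem natCast_eq_one_of_odd {R : Type*} [Ring R] [CharP R 2] (hn : Odd n) : (n : R) = 1 := by
  obtain ⟨k, rfl⟩ := hn
  push_cast
  rw [CharTwo.two_eq_zero, zero_mul, zero_add]

theorem IsPSL2Invariant.comp_mem (hC : IsPSL2Invariant n C) {τ : Equiv.Perm (OnePoint (ZMod n))}
    (hτ : τ ∈ PSL2 n) {c : OnePoint (ZMod n) → ZMod 2} (hc : c ∈ C) :
    (fun p => c (τ p)) ∈ C := by
  rw [← hC τ hτ]
  exact ⟨c, hc, rfl⟩

/-- The Möbius permutation attached to a matrix of determinant one. -/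
theorem exists_mobius (a b c d : ZMod n) (h : a * d - b * c = 1) :
    ∃ τ ∈ PSL2 n,
      τ OnePoint.infty = (if c = 0 then OnePoint.infty else ((a / c : ZMod n) : OnePoint _)) ∧
      ∀ x : ZMod n, τ (x : OnePoint _) =
        (if c * x + d = 0 then OnePoint.infty
          else (((a * x + b) / (c * x + d) : ZMod n) : OnePoint _)) := by
  refine ⟨_, ⟨⟨!![a, b; c, d], by rw [Matrix.det_fin_two_of, h]⟩, rfl⟩, ?_, fun x => ?_⟩
  · exact OnePoint.smul_infty_eq_ite _
  · exact OnePoint.smul_some_eq_ite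

theorem exists_translation (b : ZMod n) :
    ∃ τ ∈ PSL2 n, τ OnePoint.infty = OnePoint.infty ∧
      ∀ x : ZMod n, τ (x : OnePoint _) = ((x + b : ZMod n) : OnePoint _) := by
  obtain ⟨τ, hτ, h1, h2⟩ := exists_mobius 1 b 0 1 (by ring)
  exact ⟨τ, hτ, by simpa using h1, fun x => by simpa using h2 x⟩

theorem exists_dilation {a : ZMod n} (ha : a ≠ 0) :
    ∃ τ ∈ PSL2 n, τ OnePoint.infty = OnePoint.infty ∧
      ∀ x : ZMod n, τ (x : OnePoint _) = ((a ^ 2 * x : ZMod n) : OnePoint _) := by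
  obtain ⟨τ, hτ, h1, h2⟩ := exists_mobius a 0 0 a⁻¹ (by field_simp; ring)
  refine ⟨τ, hτ, by simpa using h1, fun x => ?_⟩
  rw [h2 x, if_neg (by simpa using ha)]
  congr 1
  field_simp
  ring

theorem exists_map_infty (p : OnePoint (ZMod n)) : ∃ τ ∈ PSL2 n, τ OnePoint.infty = p := by
  induction p using OnePoint.rec with
  | infty => exact ⟨1, one_mem _, rfl⟩
  | coe x =>
    obtain ⟨τ, hτ, h1, -⟩ := exists_mobius x (-1) 1 0 (by ring)
    exact ⟨τ, hτ, by simpa using h1⟩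

/-- The sum of all translates of a word. -/
theorem IsPSL2Invariant.sum_translates_mem (hn : Odd n) (hC : IsPSL2Invariant n C)
    {c : OnePoint (ZMod n) → ZMod 2} (hc : c ∈ C) :
    (fun p : OnePoint (ZMod n) => p.elim (c OnePoint.infty) fun _ => ∑ x : ZMod n, c x) ∈ C := by
  choose τ hτ h1 h2 using exists_translation (n := n)
  convert C.sum_mem (t := Finset.univ) fun b _ => hC.comp_mem (hτ b) hc using 1
  ext p
  rw [Finset.sum_apply]
  induction p using OnePoint.rec with
  | infty =>
    -- Translations fix `∞`, so its coordinate is counted `n` times, and `n = 1` in characteristic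
    -- 2.
    simp [h1, ZMod.card, natCast_eq_one_of_odd hn]
  | coe x =>
    simp only [h2, OnePoint.elim_some]
    exact (Equiv.sum_comp (Equiv.addLeft x) fun y : ZMod n => c (y : OnePoint (ZMod n))).symm

theorem IsPSL2Invariant.eq_top_of_single_infty_mem [DecidableEq (OnePoint (ZMod n))]
    (hC : IsPSL2Invariant n C)
    (h : (Pi.single OnePoint.infty 1 : OnePoint (ZMod n) → ZMod 2) ∈ C) : C = ⊤ := by
  have key (p : OnePoint (ZMod n)) : (Pi.single p 1 : OnePoint (ZMod n) → ZMod 2) ∈ C := by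
    obtain ⟨τ, hτ, h1⟩ := exists_map_infty p
    convert hC.comp_mem (inv_mem hτ) h using 1
    ext q
    simp only [Pi.single_apply, Equiv.Perm.inv_eq_iff_eq, h1]
  rw [eq_top_iff]
  rintro c -
  rw [← Finset.univ_sum_single c]
  refine C.sum_mem fun p _ => ?_
  simpa [← Pi.single_smul] using C.smul_mem (c p) (key p)

/-- A word violating the equality yields the unit vector at `∞`, whose orbit spans the whole space.
-/
theorem IsPSL2Invariant.sum_eq_infty (hn : Odd n) (hC : IsPSL2Invariant n C) (hT : C ≠ ⊤)
    {c : OnePoint (ZMod n) → ZMod 2} (hc : c ∈ C) : ∑ x : ZMod n, c x = c OnePoint.infty := by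
  classical
  by_contra hne
  apply hT
  apply hC.eq_top_of_single_infty_mem
  have hw := hC.sum_translates_mem hn hc
  by_cases h0 : c OnePoint.infty = 0
  · rw [h0] at hne
    rw [h0, zmod_two_eq_one hne] at hw
    -- The word `hw` vanishes only at `∞`. Adding its image under `x ↦ -1/x` leaves the support `{0,
    -- ∞}`, whose translates sum to the all-ones word; adding `hw` back isolates `∞`.
    obtain ⟨τ, hτ, h1, h2⟩ := exists_mobius (n := n) 0 (-1) 1 0 (by ring)
    have h3 := C.add_mem hw (hC.comp_mem hτ hw)
    have h4 := C.add_mem hw (hC.sum_translates_mem hn h3)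
    convert h4 using 1
    ext p
    have h5 (x : ZMod n) : (τ x).elim (0 : ZMod 2) (fun _ => 1) = if x = 0 then 0 else 1 := by
      rw [h2]; split_ifs <;> simp_all
    have h6 : ∑ x : ZMod n, (1 + if x = 0 then (0 : ZMod 2) else 1) = 1 := by
      rw [Finset.sum_eq_single 0]
      · simp
      · intro b _ hb; simp [hb, CharTwo.add_self_eq_zero]
      · simp
    induction p using OnePoint.rec with
    | infty => simp [h1]
    | coe x => simp [h5, h6, CharTwo.add_self_eq_zero]
  -- Here the sum of the translates is already the unit vector at `∞`.
  · have h1 := zmod_two_eq_one h0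
    rw [h1] at hne
    have h2 : ∑ x : ZMod n, c x = 0 := by
      by_contra h; exact hne (zmod_two_eq_one h)
    rw [h1, h2] at hw
    convert hw using 1
    ext p
    induction p using OnePoint.rec with
    | infty => simp
    | coe x => simp

/-- Move a nonzero coordinate to `∞`; by `sum_eq_infty` the translates of the resulting word then
sum to the all-ones word. -/
theorem IsPSL2Invariant.one_mem (hn : Odd n) (hC : IsPSL2Invariant n C) (hT : C ≠ ⊤)
    (hB : C ≠ ⊥) : (1 : OnePoint (ZMod n) → ZMod 2) ∈ C := by
  obtain ⟨c, hc, hne⟩ := C.ne_bot_iff.1 hB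
  obtain ⟨p, hp⟩ := Function.ne_iff.1 hne
  obtain ⟨τ, hτ, h1⟩ := exists_map_infty p
  have hd := hC.comp_mem hτ hc
  have hs := hC.sum_eq_infty hn hT hd
  have hw := hC.sum_translates_mem hn hd
  simp only [hs, h1, zmod_two_eq_one hp] at hw
  convert hw using 1
  ext q
  induction q using OnePoint.rec <;> simp

theorem IsPSL2Invariant.eq_extendedCode (hn : Odd n) (hC : IsPSL2Invariant n C) (hT : C ≠ ⊤) :
    C = extendedCode n (C.comap (extendWord n)) := by
  rw [extendedCode, Submodule.map_comap_eq, right_eq_inf]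
  intro c hc
  refine ⟨fun x => c x, ?_⟩
  ext p
  induction p using OnePoint.rec with
  | infty =>
    change -∑ x : ZMod n, c x = _
    rw [CharTwo.neg_eq, hC.sum_eq_infty hn hT hc]
  | coe x => rfl

/-- The parity coordinate is a symmetric sum, so permutations fixing `∞` commute with extension and
act on the punctured code. -/
theorem extendWord_comp {τ : Equiv.Perm (OnePoint (ZMod n))} {σ : Equiv.Perm (ZMod n)}
    (h1 : τ OnePoint.infty = OnePoint.infty) (h2 : ∀ x : ZMod n, τ x = (σ x : ZMod n))
    (c : ZMod n → ZMod 2) :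
    (fun p => extendWord n c (τ p)) = extendWord n fun x => c (σ x) := by
  ext p
  induction p using OnePoint.rec with
  | infty =>
    rw [h1]
    change -∑ x, c x = -∑ x, c (σ x)
    rw [Equiv.sum_comp]
  | coe x => rw [h2]; rfl

theorem IsPSL2Invariant.translate_mem (hC : IsPSL2Invariant n C) (b : ZMod n)
    {c : ZMod n → ZMod 2} (hc : c ∈ C.comap (extendWord n)) :
    (fun x => c (x + b)) ∈ C.comap (extendWord n) := by
  obtain ⟨τ, hτ, h1, h2⟩ := exists_translation b
  have := hC.comp_mem hτ hc
  rwa [extendWord_comp (σ := Equiv.addRight b) h1 h2] at this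

theorem IsPSL2Invariant.dilate_mem (hC : IsPSL2Invariant n C) {a : ZMod n} (ha : a ≠ 0)
    {c : ZMod n → ZMod 2} (hc : c ∈ C.comap (extendWord n)) :
    (fun x => c (a ^ 2 * x)) ∈ C.comap (extendWord n) := by
  obtain ⟨τ, hτ, h1, h2⟩ := exists_dilation ha
  have := hC.comp_mem hτ hc
  rwa [extendWord_comp (σ := Equiv.mulLeft₀ (a ^ 2) (pow_ne_zero 2 ha)) h1 h2] at this

theorem extendWord_one (hn : Odd n) : extendWord n 1 = 1 := by
  ext p
  induction p using OnePoint.rec with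
  | infty =>
    change -∑ x : ZMod n, (1 : ZMod 2) = 1
    simp [ZMod.card, natCast_eq_one_of_odd hn]
  | coe x => rfl

end Invariance

end PSLCodes

noncomputable section

namespace PSLCodes

/-! ### Cyclic codes and their generator polynomials -/

section Cyclic

variable {n : ℕ} [Fact n.Prime]

/-- The word of a polynomial, with exponents read modulo `n`. -/
def fold (n : ℕ) : (ZMod 2)[X] →ₗ[ZMod 2] (ZMod n → ZMod 2) :=
  Polynomial.lsum fun k => LinearMap.single (ZMod 2) (fun _ : ZMod n => ZMod 2) (k : ZMod n)

theorem fold_monomial (k : ℕ) (a : ZMod 2) :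
    fold n (monomial k a) = Pi.single (k : ZMod n) a := by
  rw [fold, Polynomial.lsum_apply, Polynomial.sum_monomial_index]
  · rfl
  · simp

theorem fold_wordPoly (c : ZMod n → ZMod 2) : fold n (wordPoly n c) = c := by
  simp only [wordPoly, LinearMap.sum_apply, LinearMap.comp_apply, LinearMap.proj_apply, map_sum,
    fold_monomial, ZMod.natCast_val, ZMod.cast_id', id_eq, Finset.univ_sum_single]

theorem fold_X_mul (p : (ZMod 2)[X]) : fold n (X * p) = fun x => fold n p (x + -1) := by
  induction p using Polynomial.induction_on' with
  | add p q hp hq => rw [mul_add, map_add, hp, hq, map_add]; rfl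
  | monomial k a =>
    rw [X_mul_monomial, fold_monomial, fold_monomial]
    ext x
    simp only [Pi.single_apply, Nat.cast_add, Nat.cast_one, ← sub_eq_add_neg, sub_eq_iff_eq_add]

theorem fold_X_pow_sub_one : fold n (X ^ n - 1) = 0 := by
  rw [map_sub, ← monomial_one_right_eq_X_pow, ← monomial_zero_one, fold_monomial, fold_monomial]
  simp

/-- The ideal of polynomials whose word lies in a cyclic code. -/
def cyclicIdeal (D : Submodule (ZMod 2) (ZMod n → ZMod 2))
    (hD : ∀ b, ∀ c ∈ D, (fun x => c (x + b)) ∈ D) : Ideal (ZMod 2)[X] where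
  __ := (D.comap (fold n)).toAddSubmonoid
  smul_mem' r p hp := by
    change fold n (r * p) ∈ D
    induction r using Polynomial.induction_on' with
    | add r s hr hs => rw [add_mul, map_add]; exact D.add_mem hr hs
    | monomial k a =>
      rw [← C_mul_X_pow_eq_monomial, mul_assoc, ← smul_eq_C_mul, map_smul]
      refine D.smul_mem _ ?_
      induction k with
      | zero => simpa using hp
      -- Multiplication by `X` is the cyclic shift, that is, translation by `-1`.
      | succ k ih => rw [pow_succ', mul_assoc, fold_X_mul]; exact hD _ _ ih

/-- Since `g` divides the modulus, divisibility by `g` depends only on the class modulo `X ^ n - 1`.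
-/
theorem mem_cyclicCode_iff {g : (ZMod 2)[X]} (hg : g ∣ X ^ n - 1) {c : ZMod n → ZMod 2} :
    c ∈ cyclicCode n g ↔ g ∣ wordPoly n c := by
  change Ideal.Quotient.mk _ (wordPoly n c) ∈ Ideal.span {Ideal.Quotient.mk _ g} ↔ _
  rw [Ideal.mem_span_singleton]
  refine ⟨fun ⟨q, hq⟩ => ?_, fun h => map_dvd _ h⟩
  obtain ⟨q, rfl⟩ := Ideal.Quotient.mk_surjective q
  rw [← map_mul, Ideal.Quotient.mk_eq_mk_iff_sub_mem, Ideal.mem_span_singleton] at hq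
  exact (dvd_iff_dvd_of_dvd_sub (hg.trans hq)).2 (dvd_mul_right _ _)

/-- A cyclic code is generated by a divisor of `X ^ n - 1`. -/
theorem exists_generator (D : Submodule (ZMod 2) (ZMod n → ZMod 2))
    (hD : ∀ b, ∀ c ∈ D, (fun x => c (x + b)) ∈ D) :
    ∃ g : (ZMod 2)[X], g ∣ X ^ n - 1 ∧ D = cyclicCode n g ∧ ∀ p, g ∣ p ↔ fold n p ∈ D := by
  obtain ⟨g, hg⟩ := (IsPrincipalIdealRing.principal (cyclicIdeal D hD)).principal
  have key (p : (ZMod 2)[X]) : g ∣ p ↔ fold n p ∈ D := by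
    rw [← Ideal.mem_span_singleton, Ideal.span, ← hg]
    rfl
  have hdvd : g ∣ X ^ n - 1 := by
    rw [key, fold_X_pow_sub_one]
    exact D.zero_mem
  refine ⟨g, hdvd, ?_, key⟩
  ext c
  rw [mem_cyclicCode_iff hdvd, key, fold_wordPoly]

theorem pow_val_mul {K : Type*} [Field K] {β : K} (hβ : β ^ n = 1) (k : ℕ) (i : ZMod n) :
    β ^ ((k : ZMod n) * i).val = (β ^ i.val) ^ k := by
  rw [← pow_mul, ← AddChar.zmodChar_apply hβ, ← AddChar.zmodChar_apply' hβ]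
  simp [mul_comm]

/-! ### Zero sets of generators -/

variable {K : Type*} [Field K] [Algebra (ZMod 2) K] {β : K}

/-- Evaluating a polynomial at a power of `β` is a Fourier transform of its word. -/
theorem aeval_pow_eq_sum (hβ : β ^ n = 1) (i : ZMod n) (p : (ZMod 2)[X]) :
    aeval (β ^ i.val) p = ∑ x : ZMod n, fold n p x • β ^ (x * i).val := by
  induction p using Polynomial.induction_on' with
  | add p q hp hq => simp only [map_add, hp, hq, Pi.add_apply, add_smul, Finset.sum_add_distrib]
  | monomial k a =>
    rw [fold_monomial, aeval_monomial, Finset.sum_eq_single (k : ZMod n)]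
    · rw [Pi.single_eq_same, pow_val_mul hβ, Algebra.smul_def]
    · intro b _ hb; simp [hb]
    · simp

/-- The exponents of the roots of a polynomial among the powers of `β`. -/
def zeroSet (n : ℕ) [Fact n.Prime] (β : K) (g : (ZMod 2)[X]) : Set (ZMod n) :=
  {i | aeval (β ^ i.val) g = 0}

/-- Over `K` the polynomial `X ^ n - 1` splits with distinct roots `β^i`, and its divisor `g`
inherits this; over `GF(2)` a nonzero polynomial is monic. -/
theorem map_eq_prod (hβ : IsPrimitiveRoot β n) {g : (ZMod 2)[X]} (hg : g ∣ X ^ n - 1)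
    {Z : Finset (ZMod n)} (hZ : zeroSet n β g = Z) :
    g.map (algebraMap (ZMod 2) K) = ∏ i ∈ Z, (X - Polynomial.C (β ^ i.val)) := by
  classical
  have hpos : 0 < n := (Fact.out : n.Prime).pos
  have hne : (X ^ n - 1 : K[X]) ≠ 0 := X_pow_sub_C_ne_zero hpos 1
  have hne2 : (X ^ n - 1 : (ZMod 2)[X]) ≠ 0 := X_pow_sub_C_ne_zero hpos 1
  have hg0 : g ≠ 0 := ne_zero_of_dvd_ne_zero hne2 hg
  have hd : g.map (algebraMap (ZMod 2) K) ∣ X ^ n - 1 := by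
    simpa using Polynomial.map_dvd (algebraMap (ZMod 2) K) hg
  have hm : g.Monic := zmod_two_eq_one (leadingCoeff_ne_zero.2 hg0)
  have hprod := X_pow_sub_one_eq_prod hpos hβ
  have hs : (g.map (algebraMap (ZMod 2) K)).Splits := by
    refine Splits.of_dvd ?_ hne hd
    rw [hprod]
    exact Splits.prod fun i _ => Splits.X_sub_C i
  have hnd : (g.map (algebraMap (ZMod 2) K)).roots.Nodup := by
    refine Multiset.nodup_of_le (Polynomial.roots.le_of_dvd hne hd) ?_
    simpa [nthRoots] using hβ.nthRoots_one_nodup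
  have hinj : Function.Injective fun i : ZMod n => β ^ i.val := fun i j h =>
    ZMod.val_injective n (hβ.pow_inj (ZMod.val_lt i) (ZMod.val_lt j) h)
  have hroots : (g.map (algebraMap (ZMod 2) K)).roots = (Z.image fun i : ZMod n => β ^ i.val).val := by
    refine (Multiset.Nodup.ext hnd (Finset.nodup _)).2 fun a => ?_
    rw [mem_roots (Polynomial.map_ne_zero hg0), Finset.mem_val, Finset.mem_image, IsRoot.def,
      eval_map_algebraMap]
    constructor
    · intro ha
      have ha1 : a ^ n = 1 := by
        have := aeval_eq_zero_of_dvd_aeval_eq_zero hg ha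
        simpa [sub_eq_zero] using this
      obtain ⟨k, hk, rfl⟩ := hβ.eq_pow_of_pow_eq_one ha1
      refine ⟨k, ?_, by rw [ZMod.val_cast_of_lt hk]⟩
      rw [← Finset.mem_coe, ← hZ]
      change aeval (β ^ _) g = 0
      rwa [ZMod.val_cast_of_lt hk]
    · rintro ⟨i, hi, rfl⟩
      rwa [← Finset.mem_coe, ← hZ] at hi
  rw [hs.eq_prod_roots_of_monic (hm.map _), hroots]
  exact Finset.prod_image fun i _ j _ h => hinj h

/-- Frobenius: `g(x^2) = g(x)^2` over `GF(2)`. -/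
theorem two_mul_mem_zeroSet (hβ : β ^ n = 1) {g : (ZMod 2)[X]} {i : ZMod n}
    (hi : i ∈ zeroSet n β g) : 2 * i ∈ zeroSet n β g := by
  change aeval _ g = 0
  rw [show (2 : ZMod n) = (2 : ℕ) by simp, pow_val_mul hβ, ← expand_aeval, ZMod.expand_card,
    map_pow, show aeval (β ^ i.val) g = 0 from hi, zero_pow two_ne_zero]

theorem sq_mul_mem_zeroSet (hβ : β ^ n = 1) {g : (ZMod 2)[X]}
    {D : Submodule (ZMod 2) (ZMod n → ZMod 2)} (hg : ∀ p, g ∣ p ↔ fold n p ∈ D)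
    (hD : ∀ a : ZMod n, a ≠ 0 → ∀ c ∈ D, (fun x => c (a ^ 2 * x)) ∈ D)
    {a : ZMod n} (ha : a ≠ 0) {i : ZMod n} (hi : i ∈ zeroSet n β g) :
    a ^ 2 * i ∈ zeroSet n β g := by
  -- Dilating the word of `g` by `a⁻¹ ^ 2` dilates its Fourier transform by `a ^ 2`, so the dilated
  -- word at `i` gives `g` at `a ^ 2 * i`.
  have h1 := hD a⁻¹ (inv_ne_zero ha) _ ((hg g).1 dvd_rfl)
  rw [← fold_wordPoly (fun x => fold n g (a⁻¹ ^ 2 * x)), ← hg] at h1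
  have h2 := aeval_eq_zero_of_dvd_aeval_eq_zero h1 hi
  rw [aeval_pow_eq_sum hβ, fold_wordPoly] at h2
  change aeval _ g = 0
  rw [aeval_pow_eq_sum hβ, ← h2, ← Equiv.sum_comp (Equiv.mulLeft₀ (a⁻¹ ^ 2) 
    (pow_ne_zero 2 (inv_ne_zero ha)))]
  refine Finset.sum_congr rfl fun x _ => ?_
  change fold n g (a⁻¹ ^ 2 * x) • β ^ (a⁻¹ ^ 2 * x * (a ^ 2 * i)).val = _
  congr 3
  field_simp

/-- The polynomial of the all-ones word is divisible by `g`, but takes the value `n = 1` at `β^0 =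
1`. -/
theorem zero_notMem_zeroSet (hn : Odd n) (hβ : β ^ n = 1) {g : (ZMod 2)[X]}
    {D : Submodule (ZMod 2) (ZMod n → ZMod 2)} (hg : ∀ p, g ∣ p ↔ fold n p ∈ D)
    (hD : 1 ∈ D) : 0 ∉ zeroSet n β g := by
  intro h
  rw [← fold_wordPoly 1, ← hg] at hD
  have h2 := aeval_eq_zero_of_dvd_aeval_eq_zero hD h
  have : CharP K 2 := charP_of_injective_algebraMap (algebraMap (ZMod 2) K).injective 2
  rw [aeval_pow_eq_sum hβ, fold_wordPoly] at h2
  simp [ZMod.card, natCast_eq_one_of_odd hn] at h2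

/-- The nonzero squares have two orbits on the nonzero classes, the residues and the nonresidues. -/
theorem zeroSet_cases {Z : Set (ZMod n)} (h0 : 0 ∉ Z)
    (hsq : ∀ a : ZMod n, a ≠ 0 → ∀ i ∈ Z, a ^ 2 * i ∈ Z) :
    Z = ∅ ∨ Z = residues n ∨ Z = nonresidues n ∨ Z = {0}ᶜ := by
  have hpos {i j : ZMod n} (hi : i ∈ Z) (hj : j ≠ 0) (hij : IsSquare (j / i)) : j ∈ Z := by
    have hi0 : i ≠ 0 := fun h => h0 (h ▸ hi)
    obtain ⟨a, ha⟩ := hij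
    have ha0 : a ≠ 0 := by
      rintro rfl
      simp [hi0, hj] at ha
    have := hsq a ha0 i hi
    rwa [sq, ← ha, div_mul_cancel₀ _ hi0] at this
  have hQ {i j : ZMod n} (hi : i ∈ Z) (hj : j ≠ 0) (h : IsSquare i ↔ IsSquare j) : j ∈ Z := by
    have hi0 : i ≠ 0 := fun h => h0 (h ▸ hi)
    refine hpos hi hj ?_
    by_cases h' : IsSquare i
    · exact (h.1 h').div h'
    · have h1 := (quadraticChar_neg_one_iff_not_isSquare (F := ZMod n)).2 h'
      have h2 := (quadraticChar_neg_one_iff_not_isSquare (F := ZMod n)).2 (mt h.2 h')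
      -- For two nonresidues, `j / i = (j * i) / (i * i)` and the product `j * i` is a residue.
      have : IsSquare (j * i) := by
        rw [← quadraticChar_one_iff_isSquare (mul_ne_zero hj hi0), map_mul, h1, h2]
        norm_num
      have h3 := this.div (IsSquare.mul_self i)
      rwa [mul_div_mul_right _ _ hi0] at h3
  by_cases hA : ∃ i ∈ Z, IsSquare i <;> by_cases hB : ∃ i ∈ Z, ¬ IsSquare i
  · obtain ⟨i, hi, hi'⟩ := hA
    obtain ⟨k, hk, hk'⟩ := hB
    refine Or.inr <| Or.inr <| Or.inr <| Set.ext fun j => ⟨fun hj h => h0 (h ▸ hj), fun hj => ?_⟩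
    by_cases h : IsSquare j
    · exact hQ hi hj (by tauto)
    · exact hQ hk hj (by tauto)
  · obtain ⟨i, hi, hi'⟩ := hA
    push Not at hB
    refine Or.inr <| Or.inl <| Set.ext fun j => ?_
    simp only [residues, Finset.coe_filter, Finset.mem_univ, true_and, Set.mem_ofPred_eq]
    exact ⟨fun hj => ⟨fun h => h0 (h ▸ hj), hB j hj⟩, fun hj => hQ hi hj.1 (by tauto)⟩
  · obtain ⟨i, hi, hi'⟩ := hB
    push Not at hA
    refine Or.inr <| Or.inr <| Or.inl <| Set.ext fun j => ?_
    simp only [nonresidues, Finset.coe_filter, Finset.mem_univ, true_and, Set.mem_ofPred_eq]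
    refine ⟨hA j, fun hj => hQ hi ?_ (by tauto)⟩
    rintro rfl
    exact hj IsSquare.zero
  · push Not at hA hB
    exact Or.inl <| Set.eq_empty_of_forall_notMem fun i hi => hA i hi (hB i hi)

theorem isSquare_two_of_zeroSet (hn : Odd n) (hβ : β ^ n = 1) {g : (ZMod 2)[X]}
    (h : zeroSet n β g = residues n ∨ zeroSet n β g = nonresidues n) : IsSquare (2 : ZMod n) := by
  have h20 : (2 : ZMod n) ≠ 0 := by
    intro h
    have h1 : ((2 : ℕ) : ZMod n) = 0 := by simpa using h
    rw [ZMod.natCast_eq_zero_iff, Nat.dvd_prime Nat.prime_two] at h1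
    rcases h1 with rfl | rfl
    · exact Nat.not_prime_one Fact.out
    · exact absurd hn (by decide)
  -- If `2` were a nonresidue, doubling would send the residue `1` to `2`, and the nonresidue `2` to
  -- the square `4`.
  by_contra h2
  rcases h with h | h
  · have h1 : (1 : ZMod n) ∈ zeroSet n β g := by
      rw [h]; simp [residues]
    have h3 := two_mul_mem_zeroSet hβ h1
    rw [h] at h3
    simp [residues, h2] at h3
  · have h1 : (2 : ZMod n) ∈ zeroSet n β g := by
      rw [h]; simp [nonresidues, h2]
    have h3 := two_mul_mem_zeroSet hβ h1
    rw [h] at h3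
    simp [nonresidues] at h3

theorem degree_wordPoly_lt (c : ZMod n → ZMod 2) : (wordPoly n c).degree < n := by
  rw [wordPoly, LinearMap.sum_apply, degree_lt_iff_coeff_zero]
  intro k hk
  rw [finsetSum_coeff]
  refine Finset.sum_eq_zero fun i _ => coeff_monomial_of_ne _ ?_
  exact ((ZMod.val_lt i).trans_le hk).ne'

/-- Here `g` has degree `n - 1`, the largest degree a word polynomial can have, so the cofactor is a
nonzero constant and only one nonzero word exists. -/
theorem eq_zero_or_one_of_zeroSet_eq (hβ : IsPrimitiveRoot β n) {g : (ZMod 2)[X]} (hg : g ∣ X ^ n - 1)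
    (hZ : zeroSet n β g = {0}ᶜ) {D : Submodule (ZMod 2) (ZMod n → ZMod 2)}
    (hD : D = cyclicCode n g) (h1 : 1 ∈ D) {c : ZMod n → ZMod 2} (hc : c ∈ D) :
    c = 0 ∨ c = 1 := by
  have hmap := map_eq_prod (Z := {0}ᶜ) hβ hg (by simpa using hZ)
  have hdeg : g.natDegree = n - 1 := by
    rw [← natDegree_map (algebraMap (ZMod 2) K), hmap, natDegree_prod_of_monic _ _
      fun i _ => monic_X_sub_C _]
    simp only [natDegree_X_sub_C]
    simp [Finset.card_compl, ZMod.card]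
  have hpos : 0 < n := (Fact.out : n.Prime).pos
  have hquot {d : ZMod n → ZMod 2} (hd : d ∈ D) : d ≠ 0 → wordPoly n d = g := by
    intro hd0
    rw [hD, mem_cyclicCode_iff hg] at hd
    obtain ⟨q, hq⟩ := hd
    have hw : wordPoly n d ≠ 0 := fun h => hd0 <| by rw [← fold_wordPoly d, h, map_zero]
    have hlt := (natDegree_lt_iff_degree_lt hw).2 (degree_wordPoly_lt d)
    have hgq : g ≠ 0 ∧ q ≠ 0 := by rwa [hq, mul_ne_zero_iff] at hw
    rw [hq, natDegree_mul hgq.1 hgq.2, hdeg] at hlt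
    have hq0 : q.natDegree = 0 := by omega
    rw [hq, eq_C_of_natDegree_eq_zero hq0, zmod_two_eq_one (x := q.coeff 0), C_1, mul_one]
    intro h
    exact hgq.2 (by rw [eq_C_of_natDegree_eq_zero hq0, h, C_0])
  by_cases h : c = 0
  · exact Or.inl h
  · right
    rw [← fold_wordPoly c, ← fold_wordPoly 1, hquot hc h, hquot h1 one_ne_zero]

end Cyclic

/-! ### Primitivity of the root of unity -/

theorem isPrimitiveRoot_rootOfUnity {n : ℕ} [Fact n.Prime] (hn : Odd n) (α : (RootField n)ˣ)
    (hα : ∀ x, x ∈ Subgroup.zpowers α) : IsPrimitiveRoot (rootOfUnity n α) n := by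
  have hc : IsUnit (2 : ZMod n) := by
    have := (ZMod.isUnit_iff_coprime 2 n).2 (Nat.coprime_two_left.2 hn)
    simpa using this
  -- An order of `0` would mean infinite order; it is excluded because `2` is a unit modulo the odd
  -- `n`.
  have hm : orderOf (2 : ZMod n) ≠ 0 := by
    obtain ⟨u, hu⟩ := hc
    rw [← hu, orderOf_units]
    exact (orderOf_pos u).ne'
  have hcard : Nat.card (RootField n)ˣ = 2 ^ orderOf (2 : ZMod n) - 1 := by
    rw [Nat.card_units, GaloisField.card 2 _ hm]
  have hdvd : n ∣ 2 ^ orderOf (2 : ZMod n) - 1 := by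
    rw [← ZMod.natCast_eq_zero_iff, Nat.cast_sub Nat.one_le_two_pow]
    push_cast
    rw [pow_orderOf_eq_one, sub_self]
  have hprim : IsPrimitiveRoot (α : RootField n) (2 ^ orderOf (2 : ZMod n) - 1) := by
    rw [IsPrimitiveRoot.coe_units_iff, ← hcard, ← orderOf_eq_card_of_forall_mem_zpowers hα]
    exact IsPrimitiveRoot.orderOf α
  have hpos : 2 ^ orderOf (2 : ZMod n) - 1 ≠ 0 := by
    have := Nat.one_lt_two_pow hm
    omega
  exact hprim.pow (Nat.pos_of_ne_zero hpos) (Nat.div_mul_cancel hdvd).symm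

end PSLCodes

end

/-! ### The classification -/

theorem theorem3p2 (n : ℕ) [Fact n.Prime] (hn : Odd n)
    (α : (PSLCodes.RootField n)ˣ) (hα : ∀ x, x ∈ Subgroup.zpowers α)
    (C : Submodule (ZMod 2) (OnePoint (ZMod n) → ZMod 2))
    (hC : PSLCodes.IsPSL2Invariant n C) :
    C = ⊥ ∨
    C = ⊤ ∨
    (C : Set (OnePoint (ZMod n) → ZMod 2)) = {0, 1} ∨
    (C : Set (OnePoint (ZMod n) → ZMod 2)) = {c | ∑ x, c x = 0} ∨
    ∃ D : Submodule (ZMod 2) (ZMod n → ZMod 2),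
      PSLCodes.IsOddLikeQRCode n (PSLCodes.rootOfUnity n α) D ∧
        C = PSLCodes.extendedCode n D := by
  open PSLCodes in
  by_cases hB : C = ⊥
  · exact Or.inl hB
  by_cases hT : C = ⊤
  · exact Or.inr (Or.inl hT)
  refine Or.inr (Or.inr ?_)
  have hβ := isPrimitiveRoot_rootOfUnity hn α hα
  set β := rootOfUnity n α
  have hE := hC.eq_extendedCode hn hT
  set D := C.comap (extendWord n) with hDdef
  have h1C := hC.one_mem hn hT hB
  have h1D : 1 ∈ D := by
    rw [hDdef, Submodule.mem_comap, extendWord_one hn]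
    exact h1C
  obtain ⟨g, hg, hDg, hmem⟩ := exists_generator D fun b c hc => hC.translate_mem b hc
  have h0 := zero_notMem_zeroSet hn hβ.pow_eq_one hmem h1D
  have hQR (h : zeroSet n β g = residues n ∨ zeroSet n β g = nonresidues n) :
      IsOddLikeQRCode n β D :=
    ⟨isSquare_two_of_zeroSet hn hβ.pow_eq_one h, g, h.imp (map_eq_prod hβ hg) (map_eq_prod hβ hg),
      hDg⟩
  rcases zeroSet_cases h0 fun a ha i hi => sq_mul_mem_zeroSet hβ.pow_eq_one hmem
    (fun a ha c hc => hC.dilate_mem ha hc) ha hi with h | h | h | h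
  -- With no zeros, `g = 1` and every word lies in `D`, so only the parity condition remains.
  · have hg1 : g = 1 := by
      have := map_eq_prod (Z := ∅) hβ hg (by simpa using h)
      rw [Finset.prod_empty, ← Polynomial.map_one (algebraMap (ZMod 2) (RootField n))] at this
      exact Polynomial.map_injective _ (algebraMap (ZMod 2) (RootField n)).injective this
    have hDT (d : ZMod n → ZMod 2) : d ∈ D := by
      rw [hDg, mem_cyclicCode_iff hg, hg1]
      exact one_dvd _
    refine Or.inr (Or.inl ?_)
    ext c
    rw [Set.mem_ofPred_eq, SetLike.mem_coe]
    have hsum : ∑ x, c x = c OnePoint.infty + ∑ x : ZMod n, c x := Fintype.sum_option c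
    rw [hsum]
    constructor
    · intro hc
      rw [hC.sum_eq_infty hn hT hc, CharTwo.add_self_eq_zero]
    · intro hc
      rw [hE]
      refine ⟨fun x => c x, hDT _, ?_⟩
      ext p
      induction p using OnePoint.rec with
      | infty =>
        change -∑ x : ZMod n, c x = _
        exact (eq_neg_of_add_eq_zero_left hc).symm
      | coe x => rfl
  · exact Or.inr (Or.inr ⟨D, hQR (Or.inl h), hE⟩)
  · exact Or.inr (Or.inr ⟨D, hQR (Or.inr h), hE⟩)
  · refine Or.inl (Set.ext fun c => ⟨fun hc => ?_, ?_⟩)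
    · rw [SetLike.mem_coe, hE] at hc
      obtain ⟨d, hd, rfl⟩ := hc
      rcases eq_zero_or_one_of_zeroSet_eq hβ hg h hDg h1D hd with rfl | rfl
      · exact Or.inl (map_zero _)
      · exact Or.inr (extendWord_one hn)
    · rintro (rfl | rfl)
      · exact C.zero_mem
      · exact h1C
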